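/- **Theorem 2.6.** Let $k\ge 2$, let $|\cdot|$ be the Euclidean norm and $m$ the Lebesgue measure on $\mathbb{R}^k$, and let $g:(0,\infty)\to(0,\infty)$ be strictly decreasing with $g(0^+)=+\infty$. Let $0<p_*<k$, let $\Omega\subset\mathbb{R}^k$ be a bounded open set, let $B\subset\mathbb{R}^k$ be closed and nonempty, and let $A\subset\Omega$ be a compact set with $m(A)=0$ that is $p_*$-admissible, i.e. there is a constant $C$ such that $$m\big(\{y\in\mathbb{R}^k\setminus A:\ 0<\operatorname{dist}(y,A)\le\sigma\}\cap B(x,R)\big)\le C\,\sigma^{k-p_*}R^{p_*}\qquad\text{for all }x\in\mathbb{R}^k,\ R,\sigma>0,$$ where $B(x,R)$ is the open ball (if $A=\emptyset$, the set on the left is understood to be empty). A *Hardy field* is a subfield $\mathfrak{R}$ of the ring of germs at $+\infty$ of real-valued functions (defined on half-lines $[M,+\infty)$, two functions being identified if they coincide on some half-line) such that each element of $\mathfrak{R}$ is represented by a differentiable function on some half-line whose derivative also represents an element of $\mathfrak{R}$. Suppose that $t\mapsto g(1/t)$ belongs to a Hardy field that contains all the functions $t^\gamma$, $\gamma\in\mathbb{R}$,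 and that for some $\beta>0$ and $C_1>0$ one has $g(t)\le C_1t^{-\beta}$ for $t\in(0,1]$. Then for every $a>1$ there is a constant $v\in(0,1)$ such that every subharmonic function $u:\Omega\setminus B\to[-\infty,\infty)$ satisfying $$u(x)\le g(\operatorname{dist}(x,A\cup B)),\qquad x\in\Omega\setminus(A\cup B),$$ also satisfies $$u(x)\le a\,g(v\operatorname{dist}(x,B)),\qquad x\in\Omega\setminus B.$$ -/

import Mathlib

open Filter Topology MeasureTheory

/-- The mean value over the ball `B(x, r)` of an extended-real-valued function `u`, namely the mean
of the positive part minus the mean of the negative part. If `u` is upper semicontinuous and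
`< +∞` on the closed ball, the mean of the positive part is finite, so that the difference is the
usual integral mean in `[-∞, ∞)`. -/
noncomputable def ballMean {k : ℕ} (u : EuclideanSpace ℝ (Fin k) → EReal)
    (x : EuclideanSpace ℝ (Fin k)) (r : ℝ) : EReal :=
  (laverage (volume.restrict (Metric.ball x r)) (fun y => (u y).toENNReal) : EReal) -
    (laverage (volume.restrict (Metric.ball x r)) (fun y => (-u y).toENNReal) : EReal)

/-- Subharmonic functions `u : U → [-∞, ∞)` on an open set `U ⊆ ℝᵏ`: upper semicontinuous and with
the sub-mean-value inequality on all closed balls in `U`. Functions that are identically `-∞` on a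
component are allowed. Only the values of `u` on `U` matter. -/
def IsSubharmonicOn {k : ℕ} (u : EuclideanSpace ℝ (Fin k) → EReal)
    (U : Set (EuclideanSpace ℝ (Fin k))) : Prop :=
  UpperSemicontinuousOn u U ∧ (∀ x ∈ U, u x < ⊤) ∧
    ∀ x : EuclideanSpace ℝ (Fin k), ∀ r : ℝ, 0 < r → Metric.closedBall x r ⊆ U →
      u x ≤ ballMean u x r

/-- `[G]_σ`, the set of points outside `G` with `0 < dist(y, G) ≤ σ`
(empty if `G` is empty, since then `Metric.infDist y G = 0`). -/
def outerNeighborhood {k : ℕ} (G : Set (EuclideanSpace ℝ (Fin k))) (σ : ℝ) :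
    Set (EuclideanSpace ℝ (Fin k)) :=
  {y | y ∉ G ∧ 0 < Metric.infDist y G ∧ Metric.infDist y G ≤ σ}

/-- `p`-admissibility of a (compact) set `G ⊆ ℝᵏ`, `0 < p < k`:
`m([G]_σ ∩ B(x, R)) ≤ C σ^(k-p) R^p` for all `x`, `R > 0`, `σ > 0`. -/
def IsAdmissible {k : ℕ} (p : ℝ) (G : Set (EuclideanSpace ℝ (Fin k))) : Prop :=
  ∃ C : ℝ, ∀ x : EuclideanSpace ℝ (Fin k), ∀ R σ : ℝ, 0 < R → 0 < σ →
    volume (outerNeighborhood G σ ∩ Metric.ball x R) ≤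
      ENNReal.ofReal (C * σ ^ ((k : ℝ) - p) * R ^ p)

/-- Hardy fields: subfields of the ring of germs at `+∞` of real functions such that every element
is the class of a function differentiable near `+∞` whose derivative again belongs to the field.
A function given near `+∞` only is extended arbitrarily to `ℝ`; the germ does not depend on it. -/
def IsHardyField (𝓡 : Subring (Filter.Germ (atTop : Filter ℝ) ℝ)) : Prop :=
  IsField 𝓡 ∧
    ∀ φ ∈ 𝓡, ∃ f : ℝ → ℝ, (f : Filter.Germ (atTop : Filter ℝ) ℝ) = φ ∧
      (∀ᶠ t in atTop, DifferentiableAt ℝ f t) ∧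
      ((deriv f : ℝ → ℝ) : Filter.Germ (atTop : Filter ℝ) ℝ) ∈ 𝓡

/-! Away from `A` the hypothesis and the monotonicity of `g` suffice. Near `A`, average `u` over
balls of radius comparable to `dist(x, B)`: a thin neighbourhood of `A` fills only a small
proportion of them (admissibility), and off it `u` is controlled by `g`. What `u` does on that
neighbourhood is bounded by Domar's iteration (`IsSubharmonicOn.le_of_le_geometric`): semicontinuity
gives some finite bound, of unknown size, which descends by averaging to a bound in terms of `g`
alone. The iteration halves radii, so it needs `g` to be doubling at `0`; this follows from the
Hardy field and the power bound (`IsHardyField.exists_doubling`). One more averaging, with a still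
thinner neighbourhood, turns the resulting factor 2 into `a`. -/

/-! ### Hardy fields and doubling. -/

/-- A continuous function without zeros on a half-line has constant sign there. -/
lemma pos_or_neg_of_ne_zero_on_Ici {h : ℝ → ℝ} {M : ℝ} (hc : ContinuousOn h (Set.Ici M))
    (h0 : ∀ t ∈ Set.Ici M, h t ≠ 0) :
    (∀ t ∈ Set.Ici M, 0 < h t) ∨ (∀ t ∈ Set.Ici M, h t < 0) := by
  by_contra! hcon
  obtain ⟨⟨x, hx, hx0⟩, y, hy, hy0⟩ := hcon
  obtain ⟨z, hz, hz0⟩ := isPreconnected_Ici.intermediate_value hx hy hc ⟨hx0, hy0⟩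
  exact h0 z hz hz0

/-- Elements of a Hardy field have eventually constant sign. -/
lemma IsHardyField.eventually_sign {𝓡 : Subring (Filter.Germ (atTop : Filter ℝ) ℝ)}
    (hR : IsHardyField 𝓡) {h : ℝ → ℝ} (hh : (h : Filter.Germ (atTop : Filter ℝ) ℝ) ∈ 𝓡) :
    (∀ᶠ t in atTop, 0 ≤ h t) ∨ (∀ᶠ t in atTop, h t ≤ 0) := by
  by_cases h0 : (h : Filter.Germ (atTop : Filter ℝ) ℝ) = 0
  · left
    have h0' : (h : Filter.Germ (atTop : Filter ℝ) ℝ) = ((0 : ℝ → ℝ) : Germ atTop ℝ) := h0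
    filter_upwards [Germ.coe_eq.1 h0'] with t ht
    simp [ht]
  obtain ⟨f, hfh, hfd, -⟩ := hR.2 _ hh
  obtain ⟨b, hb⟩ := hR.1.mul_inv_cancel (a := ⟨_, hh⟩) (fun hc => h0 (congrArg Subtype.val hc))
  obtain ⟨b, hb'⟩ := b
  induction b using Filter.Germ.inductionOn with
  | _ b =>
  have hb1 : ((h * b : ℝ → ℝ) : Germ (atTop : Filter ℝ) ℝ) = ((1 : ℝ → ℝ) : Germ atTop ℝ) :=
    congrArg Subtype.val hb
  -- An invertible germ has no zeros near infinity.
  have hne : ∀ᶠ t in atTop, f t ≠ 0 := by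
    filter_upwards [Germ.coe_eq.1 hb1, Germ.coe_eq.1 hfh] with t ht hft hf0
    rw [hf0] at hft
    simp [← hft] at ht
  obtain ⟨M, hM⟩ := eventually_atTop.1 (hne.and hfd)
  have key := pos_or_neg_of_ne_zero_on_Ici (h := f) (M := M)
    (fun t ht => (hM t ht).2.continuousAt.continuousWithinAt) (fun t ht => (hM t ht).1)
  refine key.imp (fun hs => ?_) (fun hs => ?_)
  · filter_upwards [eventually_ge_atTop M, Germ.coe_eq.1 hfh] with t ht hft
    exact hft ▸ (hs t ht).le
  · filter_upwards [eventually_ge_atTop M, Germ.coe_eq.1 hfh] with t ht hft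
    exact hft ▸ (hs t ht).le

/-- Elements of a Hardy field are eventually monotone. -/
lemma IsHardyField.exists_monotoneOn_or_antitoneOn
    {𝓡 : Subring (Filter.Germ (atTop : Filter ℝ) ℝ)} (hR : IsHardyField 𝓡) {h : ℝ → ℝ}
    (hh : (h : Filter.Germ (atTop : Filter ℝ) ℝ) ∈ 𝓡) :
    ∃ M : ℝ, MonotoneOn h (Set.Ici M) ∨ AntitoneOn h (Set.Ici M) := by
  obtain ⟨f, hfh, hfd, hf'⟩ := hR.2 _ hh
  have hev := hfd.and (Germ.coe_eq.1 hfh)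
  rcases hR.eventually_sign hf' with hs | hs
  all_goals
    obtain ⟨M, hM⟩ := eventually_atTop.1 (hev.and hs)
    have hcont : ContinuousOn f (Set.Ici M) :=
      fun t ht => (hM t ht).1.1.continuousAt.continuousWithinAt
    have hdiff : DifferentiableOn ℝ f (interior (Set.Ici M)) :=
      fun t ht => (hM t (interior_subset ht)).1.1.differentiableWithinAt
    have heq : Set.EqOn f h (Set.Ici M) := fun t ht => (hM t ht).1.2
  · exact ⟨M, Or.inl ((monotoneOn_of_deriv_nonneg (convex_Ici M) hcont hdiff
      fun t ht => (hM t (interior_subset ht)).2).congr heq)⟩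
  · exact ⟨M, Or.inr ((antitoneOn_of_deriv_nonpos (convex_Ici M) hcont hdiff
      fun t ht => (hM t (interior_subset ht)).2).congr heq)⟩

/-- A function of at most polynomial growth at `0` whose reflection belongs to a Hardy field
is doubling near `0`. -/
lemma IsHardyField.exists_doubling {𝓡 : Subring (Filter.Germ (atTop : Filter ℝ) ℝ)}
    (hR : IsHardyField 𝓡)
    (hR_pow : ∀ γ : ℝ, ((fun t : ℝ => t ^ γ : ℝ → ℝ) : Filter.Germ (atTop : Filter ℝ) ℝ) ∈ 𝓡)
    {g : ℝ → ℝ} (hg_pos : ∀ t : ℝ, 0 < t → 0 < g t)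
    (hgR : ((fun t : ℝ => g (1 / t) : ℝ → ℝ) : Filter.Germ (atTop : Filter ℝ) ℝ) ∈ 𝓡)
    {β C₁ : ℝ} (hβ : 0 < β) (hg_le : ∀ t ∈ Set.Ioc (0 : ℝ) 1, g t ≤ C₁ * t ^ (-β)) :
    ∃ L s₀ : ℝ, 1 ≤ L ∧ 0 < s₀ ∧ ∀ s : ℝ, 0 < s → s ≤ s₀ → g (s / 2) ≤ L * g s := by
  -- The exponent `β + 1`, rather than `β`, makes `h` tend to `0`. Being positive and eventually
  -- monotone, `h` must then decrease, and comparing it at `1/s` and `2/s` gives doubling.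
  set h : ℝ → ℝ := fun t => g (1 / t) * t ^ (-(β + 1)) with hh
  have hmem : (h : Filter.Germ (atTop : Filter ℝ) ℝ) ∈ 𝓡 := 𝓡.mul_mem hgR (hR_pow (-(β + 1)))
  have hpos : ∀ t : ℝ, 0 < t → 0 < h t := fun t ht =>
    mul_pos (hg_pos _ (by positivity)) (Real.rpow_pos_of_pos ht _)
  have hle : ∀ t : ℝ, 1 ≤ t → h t ≤ C₁ * t⁻¹ := by
    intro t ht
    have ht0 : 0 < t := by linarith
    have h1 := hg_le (1 / t) ⟨by positivity, by rw [div_le_one ht0]; exact ht⟩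
    calc h t ≤ C₁ * (1 / t) ^ (-β) * t ^ (-(β + 1)) :=
          mul_le_mul_of_nonneg_right h1 (Real.rpow_nonneg ht0.le _)
      _ = C₁ * t⁻¹ := by
          rw [one_div, Real.inv_rpow ht0.le, ← Real.rpow_neg ht0.le, neg_neg, mul_assoc,
            ← Real.rpow_add ht0, ← Real.rpow_neg_one t]
          ring_nf
  have hlim : Tendsto (fun t : ℝ => C₁ * t⁻¹) atTop (𝓝 0) := by
    simpa using tendsto_inv_atTop_zero.const_mul C₁
  obtain ⟨M, hM⟩ := hR.exists_monotoneOn_or_antitoneOn hmem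
  have hanti : AntitoneOn h (Set.Ici M) := by
    refine hM.resolve_left fun hmono => ?_
    have hM1 : 0 < h (max M 1) := hpos _ (by positivity)
    obtain ⟨t, ht, ht'⟩ := ((hlim.eventually_lt_const hM1).and
      (eventually_ge_atTop (max M 1))).exists
    have h2 := hmono (le_max_left M 1) ((le_max_left M 1).trans ht') ht'
    linarith [hle t ((le_max_right M 1).trans ht')]
  refine ⟨2 ^ (β + 1), 1 / max M 1, Real.one_le_rpow one_le_two (by linarith), by positivity,
    fun s hs hs0 => ?_⟩
  have hsM : max M 1 ≤ 1 / s := by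
    rw [le_div_iff₀ (by positivity)] at hs0
    rw [le_div_iff₀ hs]; linarith
  have hM1 : M ≤ 1 / s := (le_max_left _ _).trans hsM
  have hs' : 0 < 1 / s := by positivity
  have h3 := hanti (a := 1 / s) (b := 2 * (1 / s)) hM1
    (show M ≤ 2 * (1 / s) by linarith) (by linarith)
  simp only [hh] at h3
  rw [Real.mul_rpow zero_le_two hs'.le, ← mul_assoc,
    mul_le_mul_iff_of_pos_right (Real.rpow_pos_of_pos hs' _), Real.rpow_neg zero_le_two,
    ← div_eq_mul_inv, div_le_iff₀ (by positivity)] at h3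
  have e1 : 1 / (2 * (1 / s)) = s / 2 := by field_simp
  have e2 : 1 / (1 / s) = s := by field_simp
  rw [e1, e2] at h3
  linarith

/-! ### Averaging and Domar's iteration. -/

/-- If a subharmonic function is at most `M` on a ball, and at most `m` off a set occupying a
proportion at most `q` of the ball, then its value at the centre is at most `m + M * q`. -/
lemma IsSubharmonicOn.le_of_le_off_small {k : ℕ} {u : EuclideanSpace ℝ (Fin k) → EReal}
    {U E : Set (EuclideanSpace ℝ (Fin k))} (hu : IsSubharmonicOn u U)
    {x : EuclideanSpace ℝ (Fin k)} {r m M q : ℝ} (hr : 0 < r) (hball : Metric.closedBall x r ⊆ U)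
    (hm : 0 ≤ m) (hM : 0 ≤ M) (hq : 0 ≤ q) (hE : MeasurableSet E)
    (hEq : volume (E ∩ Metric.ball x r) ≤ ENNReal.ofReal q * volume (Metric.ball x r))
    (huM : ∀ y ∈ Metric.ball x r, u y ≤ (M : EReal))
    (hum : ∀ y ∈ Metric.ball x r, y ∉ E → u y ≤ (m : EReal)) :
    u x ≤ ((m + M * q : ℝ) : EReal) := by
  have hV0 : volume (Metric.ball x r) ≠ 0 := (Metric.measure_ball_pos _ x hr).ne'
  have hVt : volume (Metric.ball x r) ≠ ⊤ := measure_ball_lt_top.ne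
  have hint : ∫⁻ y in Metric.ball x r, (u y).toENNReal ≤
      ENNReal.ofReal (m + M * q) * volume (Metric.ball x r) := by
    calc ∫⁻ y in Metric.ball x r, (u y).toENNReal
        ≤ ∫⁻ y in Metric.ball x r,
            (ENNReal.ofReal m + E.indicator (fun _ => ENNReal.ofReal M) y) := by
          refine setLIntegral_mono' measurableSet_ball fun y hy => ?_
          by_cases hyE : y ∈ E
          · rw [Set.indicator_of_mem hyE]
            exact (EReal.toENNReal_le_toENNReal (huM y hy)).trans le_add_self
          · rw [Set.indicator_of_notMem hyE, add_zero]
            exact EReal.toENNReal_le_toENNReal (hum y hy hyE)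
      _ = ENNReal.ofReal m * volume (Metric.ball x r)
            + ENNReal.ofReal M * volume (E ∩ Metric.ball x r) := by
          rw [lintegral_add_left measurable_const, lintegral_indicator hE, setLIntegral_const,
            setLIntegral_const, Measure.restrict_apply hE]
      _ ≤ ENNReal.ofReal m * volume (Metric.ball x r)
            + ENNReal.ofReal M * (ENNReal.ofReal q * volume (Metric.ball x r)) := by gcongr
      _ = ENNReal.ofReal (m + M * q) * volume (Metric.ball x r) := by
          rw [ENNReal.ofReal_add hm (by positivity), ENNReal.ofReal_mul hM]; ring
  have hav : laverage (volume.restrict (Metric.ball x r)) (fun y => (u y).toENNReal) ≤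
      ENNReal.ofReal (m + M * q) := by
    rw [laverage_eq, Measure.restrict_apply_univ]
    exact ENNReal.div_le_of_le_mul hint
  calc u x ≤ ballMean u x r := hu.2.2 x r hr hball
    _ ≤ ((ENNReal.ofReal (m + M * q) : ENNReal) : EReal) - 0 :=
        EReal.sub_le_sub (EReal.coe_ennreal_le_coe_ennreal_iff.2 hav) (EReal.coe_ennreal_nonneg _)
    _ = ((m + M * q : ℝ) : EReal) := by
        rw [sub_zero, EReal.coe_ennreal_ofReal, max_eq_left (by positivity)]

/-- Domar's iteration: a subharmonic function whose superlevel sets above `g σ` are contained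
in sets `F σ` occupying a small proportion of every ball of radius comparable with `σ`, where `g`
is doubling, is bounded at the centre of a ball
independently of how large it is elsewhere on the ball. -/
lemma IsSubharmonicOn.le_of_le_geometric {k : ℕ} {u : EuclideanSpace ℝ (Fin k) → EReal}
    {U D : Set (EuclideanSpace ℝ (Fin k))} (hu : IsSubharmonicOn u U) (hD : D ⊆ U)
    {F : ℝ → Set (EuclideanSpace ℝ (Fin k))} (hF : ∀ σ, MeasurableSet (F σ))
    {g : ℝ → ℝ} {L s₀ ε : ℝ} (hL : 1 ≤ L) (hε : 0 < ε)
    (hg : ∀ s : ℝ, 0 < s → s ≤ s₀ → g (s / 2) ≤ L * g s)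
    (hsmall : ∀ (x : EuclideanSpace ℝ (Fin k)) (R : ℝ), 0 < R →
      volume (F (ε * R) ∩ Metric.ball x R) ≤
        ENNReal.ofReal (1 / (2 * L)) * volume (Metric.ball x R))
    (huF : ∀ y ∈ D, ∀ σ : ℝ, 0 < σ → σ ≤ s₀ → y ∉ F σ → u y ≤ (g σ : EReal)) (n : ℕ) :
    ∀ (R T : ℝ) (y : EuclideanSpace ℝ (Fin k)), 0 < R → ε * R ≤ s₀ → 0 ≤ T →
      Metric.closedBall y (2 * R) ⊆ D → g (ε * R) ≤ T / 2 →
      (∀ z ∈ Metric.closedBall y (2 * R), u z ≤ ((L ^ n * T : ℝ) : EReal)) →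
      u y ≤ (T : EReal) := by
  induction n with
  | zero =>
    intro R T y hR _ _ _ _ h
    simpa using h y (Metric.mem_closedBall_self (by positivity))
  | succ n ih =>
    intro R T y hR hRs hT hyD hgT h
    -- Halving the radius raises the admissible level from `T` to `L * T`, since doubling keeps `g`
    -- at the new scale below `L * T / 2`; one factor `L` of the a priori bound is thereby absorbed.
    have hball : ∀ z ∈ Metric.closedBall y R, u z ≤ ((L * T : ℝ) : EReal) := by
      intro z hz
      have hsub : Metric.closedBall z (2 * (R / 2)) ⊆ Metric.closedBall y (2 * R) :=
        Metric.closedBall_subset_closedBall' (by rw [Metric.mem_closedBall] at hz; linarith)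
      refine ih (R / 2) (L * T) z (by positivity) ?_ (by positivity) (hsub.trans hyD) ?_ ?_
      · nlinarith [mul_pos hε hR]
      · rw [← mul_div_assoc]
        nlinarith [hg (ε * R) (by positivity) hRs]
      · intro w hw
        have := h w (hsub hw)
        rwa [pow_succ, mul_assoc] at this
    have hsub : Metric.closedBall y R ⊆ D :=
      (Metric.closedBall_subset_closedBall (by linarith)).trans hyD
    have key := hu.le_of_le_off_small hR (hsub.trans hD) (m := T / 2) (M := L * T)
      (q := 1 / (2 * L)) (by positivity) (by positivity) (by positivity) (hF _) (hsmall y R hR)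
      (fun z hz => hball z (Metric.ball_subset_closedBall hz))
      (fun z hz hzF => (huF z (hsub (Metric.ball_subset_closedBall hz)) _ (by positivity) hRs
        hzF).trans (EReal.coe_le_coe_iff.2 hgT))
    have e : T / 2 + L * T * (1 / (2 * L)) = T := by field_simp; ring
    rwa [e] at key

/-! ### Neighbourhoods of admissible sets. -/

lemma measurableSet_outerNeighborhood {k : ℕ} {G : Set (EuclideanSpace ℝ (Fin k))}
    (hG : IsClosed G) (σ : ℝ) : MeasurableSet (outerNeighborhood G σ) :=
  hG.measurableSet.compl.inter ((measurableSet_lt measurable_const measurable_infDist).inter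
    (measurableSet_le measurable_infDist measurable_const))

/-- Small neighbourhoods of a null admissible set occupy a small proportion of every ball. -/
lemma IsAdmissible.exists_small_proportion {k : ℕ} {p : ℝ} (hpk : p < k)
    {A : Set (EuclideanSpace ℝ (Fin k))} (hA : IsAdmissible p A) (hA_null : volume A = 0)
    {q : ℝ} (hq : 0 < q) :
    ∃ ε₀ : ℝ, 0 < ε₀ ∧ ∀ ε : ℝ, 0 < ε → ε ≤ ε₀ →
      ∀ (x : EuclideanSpace ℝ (Fin k)) (R : ℝ), 0 < R →
      volume ((A ∪ outerNeighborhood A (ε * R)) ∩ Metric.ball x R) ≤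
        ENNReal.ofReal q * volume (Metric.ball x R) := by
  obtain ⟨C, hC⟩ := hA
  set V := volume (Metric.ball (0 : EuclideanSpace ℝ (Fin k)) 1) with hV
  have hVt : V ≠ ⊤ := measure_ball_lt_top.ne
  have hV0 : 0 < V.toReal := ENNReal.toReal_pos (Metric.measure_ball_pos _ _ one_pos).ne' hVt
  -- After scaling by `R` the proportion depends only on `ε`, and it vanishes with `ε` because `k -
  -- p > 0`.
  have hlim : Tendsto (fun ε : ℝ => C * ε ^ ((k : ℝ) - p)) (𝓝 0) (𝓝 0) := by
    have := ((Real.continuousAt_rpow_const 0 ((k : ℝ) - p)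
      (Or.inr (by linarith))).tendsto).const_mul C
    rwa [Real.zero_rpow (by linarith), mul_zero] at this
  obtain ⟨δ, hδ, hδ'⟩ := Metric.eventually_nhds_iff.1
    (hlim.eventually_lt_const (mul_pos hq hV0))
  refine ⟨δ / 2, by positivity, fun ε hε hεδ x R hR => ?_⟩
  have hε' : C * ε ^ ((k : ℝ) - p) < q * V.toReal := hδ' (by
    rw [Real.dist_eq, sub_zero, abs_of_pos hε]; linarith)
  have hball : volume (Metric.ball x R) = ENNReal.ofReal (R ^ k) * V := by
    rw [Measure.addHaar_ball_of_pos _ _ hR, finrank_euclideanSpace_fin]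
  calc volume ((A ∪ outerNeighborhood A (ε * R)) ∩ Metric.ball x R)
      ≤ volume A + volume (outerNeighborhood A (ε * R) ∩ Metric.ball x R) := by
        rw [Set.union_inter_distrib_right]
        exact (measure_union_le _ _).trans
          (add_le_add_left (measure_mono Set.inter_subset_left) _)
    _ ≤ ENNReal.ofReal (C * (ε * R) ^ ((k : ℝ) - p) * R ^ p) := by
        rw [hA_null, zero_add]
        exact hC x R (ε * R) hR (by positivity)
    _ ≤ ENNReal.ofReal (q * V.toReal * R ^ k) := by
        apply ENNReal.ofReal_le_ofReal
        rw [Real.mul_rpow hε.le hR.le, ← mul_assoc, mul_assoc _ (R ^ _), ← Real.rpow_add hR,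
          sub_add_cancel, Real.rpow_natCast]
        gcongr
    _ = ENNReal.ofReal q * volume (Metric.ball x R) := by
        rw [hball, ENNReal.ofReal_mul (by positivity), ENNReal.ofReal_mul hq.le,
          ENNReal.ofReal_toReal hVt]
        ring

lemma le_infDist_union {α : Type*} [PseudoMetricSpace α] {s t : Set α} {x : α} {d : ℝ}
    (hs : s.Nonempty) (hds : d ≤ Metric.infDist x s)
    (hdt : d ≤ Metric.infDist x t) : d ≤ Metric.infDist x (s ∪ t) := by
  rw [Metric.le_infDist (hs.inl)]
  rintro y (hy | hy)
  · exact hds.trans (Metric.infDist_le_dist_of_mem hy)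
  · exact hdt.trans (Metric.infDist_le_dist_of_mem hy)

/-! ### From the iteration to the factor `a`. -/

/-- The bound at the centre of a ball of radius `2 * r` on which `u` is bounded by `g σ`
off sets `F σ` occupying a small proportion of all balls of radius comparable with `σ`. -/
lemma IsSubharmonicOn.le_mul_of_le_off_neighborhoods {k : ℕ}
    {u : EuclideanSpace ℝ (Fin k) → EReal}
    {U : Set (EuclideanSpace ℝ (Fin k))} (hu : IsSubharmonicOn u U)
    {F : ℝ → Set (EuclideanSpace ℝ (Fin k))} (hF : ∀ σ, MeasurableSet (F σ))
    {g : ℝ → ℝ} (hg_pos : ∀ t : ℝ, 0 < t → 0 < g t) (hg_anti : AntitoneOn g (Set.Ioi 0))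
    {L a ε ε' r : ℝ} (hL : 1 < L) (ha : 1 < a) (hε : 0 < ε) (hε1 : ε ≤ 1) (hε' : 0 < ε')
    (hεε' : ε' ≤ ε / 2) (hr : 0 < r)
    (hg : ∀ s : ℝ, 0 < s → s ≤ r → g (s / 2) ≤ L * g s)
    (hsmall : ∀ (x : EuclideanSpace ℝ (Fin k)) (R : ℝ), 0 < R →
      volume (F (ε * R) ∩ Metric.ball x R) ≤
        ENNReal.ofReal (1 / (2 * L)) * volume (Metric.ball x R))
    (hsmall' : ∀ (x : EuclideanSpace ℝ (Fin k)) (R : ℝ), 0 < R →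
      volume (F (ε' * R) ∩ Metric.ball x R) ≤
        ENNReal.ofReal ((a - 1) / 2) * volume (Metric.ball x R))
    {x : EuclideanSpace ℝ (Fin k)} (hball : Metric.closedBall x (2 * r) ⊆ U)
    (huF : ∀ y ∈ Metric.closedBall x (2 * r), ∀ σ : ℝ, 0 < σ → σ ≤ r → y ∉ F σ →
      u y ≤ (g σ : EReal)) :
    u x ≤ ((a * g (ε' * r) : ℝ) : EReal) := by
  have hbound : ∀ y ∈ Metric.ball x r, u y ≤ ((2 * g (ε * (r / 2)) : ℝ) : EReal) := by
    intro y hy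
    have hsub : Metric.closedBall y (2 * (r / 2)) ⊆ Metric.closedBall x (2 * r) :=
      Metric.closedBall_subset_closedBall' (by rw [Metric.mem_ball] at hy; linarith)
    have hT : 0 < 2 * g (ε * (r / 2)) := mul_pos two_pos (hg_pos _ (by positivity))
    obtain ⟨w, hw, hmax⟩ := (hu.1.mono (hsub.trans hball)).exists_isMaxOn
      (Metric.nonempty_closedBall.2 (by positivity)) (isCompact_closedBall y (2 * (r / 2)))
    obtain ⟨N, hN⟩ : ∃ N : ℝ, u w ≤ (N : EReal) :=
      ⟨(u w).toReal, EReal.le_coe_toReal (hu.2.1 w (hball (hsub hw))).ne⟩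
    -- The number of iterations depends on `u`, the resulting bound does not.
    obtain ⟨n, hn⟩ := ((tendsto_pow_atTop_atTop_of_one_lt hL).atTop_mul_const
      hT).eventually_ge_atTop N |>.exists
    exact hu.le_of_le_geometric hball hF hL.le hε hg hsmall huF n (r / 2) _ y (by positivity)
      (by nlinarith) hT.le hsub (by linarith)
      (fun z hz => (hmax hz).trans (hN.trans (EReal.coe_le_coe_iff.2 hn)))
  have hle : g (ε * (r / 2)) ≤ g (ε' * r) :=
    hg_anti (Set.mem_Ioi.2 (by positivity)) (Set.mem_Ioi.2 (by positivity)) (by nlinarith)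
  have hg' := hg_pos (ε' * r) (by positivity)
  -- With `m = g (ε' * r)` this averaging yields `m + 2 * m * (a - 1) / 2 = a * m`.
  have key := hu.le_of_le_off_small hr
    ((Metric.closedBall_subset_closedBall (by linarith)).trans hball) (m := g (ε' * r))
    (M := 2 * g (ε' * r)) (q := (a - 1) / 2) hg'.le (by positivity) (by linarith) (hF _)
    (hsmall' x r hr)
    (fun y hy => (hbound y hy).trans (EReal.coe_le_coe_iff.2 (by linarith)))
    (fun y hy hyF => huF y (Metric.ball_subset_closedBall.trans
      (Metric.closedBall_subset_closedBall (by linarith)) hy) _ (by positivity) (by nlinarith) hyF)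
  have e : g (ε' * r) + 2 * g (ε' * r) * ((a - 1) / 2) = a * g (ε' * r) := by ring
  rwa [e] at key

/-! ### The theorem. -/

theorem theorem2p6 (k : ℕ) (hk : 2 ≤ k) (p : ℝ) (hp0 : 0 < p) (hpk : p < k)
    (Ω A B : Set (EuclideanSpace ℝ (Fin k)))
    (hΩ_open : IsOpen Ω) (hΩ_bdd : Bornology.IsBounded Ω)
    (hB_closed : IsClosed B) (hB_ne : B.Nonempty)
    (hA_compact : IsCompact A) (hAΩ : A ⊆ Ω) (hA_adm : IsAdmissible p A)
    (hA_null : volume A = 0)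
    (g : ℝ → ℝ) (hg_pos : ∀ t : ℝ, 0 < t → 0 < g t) (hg_anti : StrictAntiOn g (Set.Ioi 0))
    (hg_top : Tendsto g (𝓝[>] 0) atTop)
    (𝓡 : Subring (Filter.Germ (atTop : Filter ℝ) ℝ)) (hR : IsHardyField 𝓡)
    (hR_pow : ∀ γ : ℝ, ((fun t : ℝ => t ^ γ : ℝ → ℝ) : Filter.Germ (atTop : Filter ℝ) ℝ) ∈ 𝓡)
    (hgR : ((fun t : ℝ => g (1 / t) : ℝ → ℝ) : Filter.Germ (atTop : Filter ℝ) ℝ) ∈ 𝓡)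
    (β C₁ : ℝ) (hβ : 0 < β) (hC₁ : 0 < C₁)
    (hg_le : ∀ t ∈ Set.Ioc (0 : ℝ) 1, g t ≤ C₁ * t ^ (-β)) :
    ∀ a : ℝ, 1 < a → ∃ v ∈ Set.Ioo (0 : ℝ) 1,
      ∀ u : EuclideanSpace ℝ (Fin k) → EReal, IsSubharmonicOn u (Ω \ B) →
        (∀ x ∈ Ω \ (A ∪ B), u x ≤ ((g (Metric.infDist x (A ∪ B)) : ℝ) : EReal)) →
        ∀ x ∈ Ω \ B, u x ≤ ((a * g (v * Metric.infDist x B) : ℝ) : EReal) := by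
  intro a ha
  obtain ⟨L, s₀, hL, hs₀, hg⟩ := hR.exists_doubling hR_pow hg_pos hgR hβ hg_le
  have hLpos : 0 < L := by linarith
  -- The doubling constant is used as `2 * L`, so that it exceeds 1 strictly and its powers diverge.
  obtain ⟨ε₁, hε₁, hsmall⟩ := hA_adm.exists_small_proportion hpk hA_null
    (q := 1 / (2 * (2 * L))) (by positivity)
  obtain ⟨ε₂, hε₂, hsmall'⟩ := hA_adm.exists_small_proportion hpk hA_null
    (q := (a - 1) / 2) (by linarith)
  obtain ⟨δ, hδ, hδΩ⟩ := hA_compact.exists_cthickening_subset_open hΩ_open hAΩ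
  obtain ⟨b, hb⟩ := hB_ne
  obtain ⟨M, hM, hΩM⟩ := hΩ_bdd.subset_ball_lt 0 b
  set ε := min ε₁ 1
  have hε : 0 < ε := by positivity
  have hε1 : ε ≤ 1 := min_le_right _ _
  set ε' := min ε₂ (ε / 2)
  have hε' : 0 < ε' := by positivity
  have hεε' : ε' ≤ ε / 2 := min_le_right _ _
  -- For radius `2 * c * d`, the `1 / 4` keeps the ball at distance at least `d / 2` from `B`, `s₀`
  -- keeps the scales in the doubling range, and `δ / 3` keeps the ball in `Ω` when `x` is within `c
  -- * d` of `A`.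
  set c := min (1 / 4) (min s₀ (δ / 3) / M)
  have hc : 0 < c := by positivity
  have hc4 : c ≤ 1 / 4 := min_le_left _ _
  have hcM : c * M ≤ min s₀ (δ / 3) := by
    rw [← le_div_iff₀ hM]; exact min_le_right _ _
  have hv1 : ε' * c < 1 := by nlinarith
  refine ⟨ε' * c, ⟨by positivity, hv1⟩, fun u hu hug x hx => ?_⟩
  set d := Metric.infDist x B
  have hd : 0 < d := (hB_closed.notMem_iff_infDist_pos ⟨b, hb⟩).1 hx.2
  have hdM : d ≤ M := (Metric.infDist_le_dist_of_mem hb).trans (Metric.mem_ball.1 (hΩM hx.1)).le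
  have hvd : 0 < ε' * c * d := by positivity
  have hfar : x ∉ A → ε' * c * d ≤ Metric.infDist x (A ∪ B) →
      u x ≤ ((a * g (ε' * c * d) : ℝ) : EReal) := by
    intro hxA hle
    refine (hug x ⟨hx.1, fun h => h.elim hxA hx.2⟩).trans (EReal.coe_le_coe_iff.2 ?_)
    have h1 := hg_anti.antitoneOn (Set.mem_Ioi.2 hvd) (Set.mem_Ioi.2 (hvd.trans_le hle)) hle
    nlinarith [hg_pos _ hvd]
  have hvd_le : ε' * c * d ≤ d := by nlinarith
  -- Empty `A` is separate because `Metric.infDist` to it is `0` by convention.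
  rcases A.eq_empty_or_nonempty with rfl | hA_ne
  · exact hfar (Set.notMem_empty x) (by rwa [Set.empty_union])
  rcases le_or_gt (ε' * c * d) (Metric.infDist x A) with hle | hlt
  · refine hfar (fun h => ?_) (le_infDist_union hA_ne hle hvd_le)
    rw [Metric.infDist_zero_of_mem h] at hle
    linarith
  obtain ⟨z, hzA, hxz⟩ := (Metric.infDist_lt_iff hA_ne).1 hlt
  have hcd : 0 < c * d := by positivity
  have hcd' : c * d ≤ min s₀ (δ / 3) := (by gcongr : c * d ≤ c * M).trans hcM
  have hcds : c * d ≤ s₀ := hcd'.trans (min_le_left _ _)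
  have hcdδ : c * d ≤ δ / 3 := hcd'.trans (min_le_right _ _)
  have hballB : ∀ y ∈ Metric.closedBall x (2 * (c * d)), d / 2 ≤ Metric.infDist y B := by
    intro y hy
    have h1 : d ≤ Metric.infDist y B + dist x y := Metric.infDist_le_infDist_add_dist
    rw [Metric.mem_closedBall, dist_comm] at hy
    nlinarith
  have hball : Metric.closedBall x (2 * (c * d)) ⊆ Ω \ B := by
    refine fun y hy => ⟨hδΩ (Metric.mem_cthickening_of_dist_le y z δ A hzA ?_), fun hyB => ?_⟩
    · rw [Metric.mem_closedBall] at hy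
      have : ε' * c * d ≤ c * d := by nlinarith
      linarith [dist_triangle y x z]
    · have := hballB y hy
      rw [Metric.infDist_zero_of_mem hyB] at this
      linarith
  rw [mul_assoc]
  refine hu.le_mul_of_le_off_neighborhoods (F := fun σ => A ∪ outerNeighborhood A σ)
    (L := 2 * L) (fun σ => hA_compact.measurableSet.union
      (measurableSet_outerNeighborhood hA_compact.isClosed σ)) hg_pos hg_anti.antitoneOn
    (by linarith) ha hε hε1 hε' hεε' hcd ?_ (hsmall ε hε (min_le_left _ _))
    (hsmall' ε' hε' (min_le_left _ _)) hball ?_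
  · intro s hs hsr
    nlinarith [hg s hs (hsr.trans hcds), hg_pos s hs]
  · intro y hy σ hσ hσr hyF
    have hyA : y ∉ A := fun h => hyF (Or.inl h)
    have hyA0 : 0 < Metric.infDist y A :=
      (hA_compact.isClosed.notMem_iff_infDist_pos hA_ne).1 hyA
    have hσA : σ ≤ Metric.infDist y A := by
      by_contra! hcon
      exact hyF (Or.inr ⟨hyA, hyA0, hcon.le⟩)
    -- At these scales `B` is farther from `y` than `σ`, so only the distance to `A` matters.
    have hσ' : σ ≤ Metric.infDist y (A ∪ B) :=
      le_infDist_union hA_ne hσA ((by nlinarith : σ ≤ d / 2).trans (hballB y hy))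
    refine (hug y ⟨(hball hy).1, fun h => h.elim hyA (hball hy).2⟩).trans
      (EReal.coe_le_coe_iff.2 ?_)
    exact hg_anti.antitoneOn (Set.mem_Ioi.2 hσ) (Set.mem_Ioi.2 (hσ.trans_le hσ')) hσ'
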